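/- **Setting.** Let $R$ be a commutative ring with identity. A *cactoid digraph* is a finite strongly connected directed graph $G$ each of whose blocks (maximal strongly connected subdigraphs on at least two vertices without cut vertices, where a cut vertex is a vertex whose deletion leaves a digraph that is disconnected when the directions of the arcs are ignored) is a directed cycle, of length at least two. It is *weighted* if every arc carries a weight in $R$. Let $G$ be a weighted cactoid digraph with vertex set $V$ and blocks $G_1,\dots,G_r$. Its *distance matrix* $W_c$ is the $V\times V$ matrix whose $(u,v)$ entry is the sum of the weights of the arcs of the shortest directed path from $u$ to $v$. Let $\mathbf j$ denote the all-ones vector. Label the vertices of $G_i$ cyclically by $\mathbb Z/n_i$, so that its arcs are $(k,k+1)$, and let $w_{i,k}$ be the weight of the arc $(k,k+1)$ of $G_i$. Put $$w_i=\sum_{0\le k\le n_i-1} w_{i,k},\qquad w_i^{(2)}=\sum_{0\le k<l\le n_i-1}w_{i,k}w_{i,l},$$ and assume that every $w_i$ is invertible in $R$. The *natural bag* of $G_i$ is the tuple $(W_i,\lambda_i,\alpha_i,\beta_i,L_i)$, where $W_i$ is the distance matrix of the weighted directed cycle $G_i$ and $$\lambda_i=\frac{w_i^{(2)}}{w_i},\qquad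 (\alpha_i)_k=\frac{w_{i,k-1}}{w_i},\qquad (\beta_i)_k=\frac{w_{i,k}}{w_i},\qquad L_i=\frac1{w_i}(I-P_i);$$ here $P_i$ is the permutation matrix with ones exactly at the entries $(k,k+1)$. The *composition* of the natural bags is the tuple $(W_c,\lambda,\alpha,\beta,L)$ with $$\lambda=\sum_{i=1}^r\lambda_i,\qquad \alpha_v=\sum_{i:\,v\in V(G_i)}(\alpha_i)_v-b(v)+1,\qquad \beta_v=\sum_{i:\,v\in V(G_i)}(\beta_i)_v-b(v)+1,\qquad L=\sum_{i=1}^r\hat L_i,$$ where $b(v)$ is the number of blocks containing $v$ and $\hat L_i$ is the $V\times V$ matrix that agrees with $L_i$ on $V(G_i)\times V(G_i)$ and is zero elsewhere. **Theorem.** The matrix $W_c$ is well defined (if there are several shortest directed paths from $u$ to $v$, they have the same weight), and its submatrix on $V(G_i)$ is $W_i$ for every $i$. The composition $(W_c,\lambda,\alpha,\beta,L)$ is a left and right $\mathrm{LapExp}^*$ bag, that is, $$\alpha^T\mathbf j=1,\quad L\mathbf j=\mathbf 0,\quad \alpha^TW_c=\lambda\mathbf j^T,\quad LW_c+I=\beta\mathbf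 j^T,$$ $$\mathbf j^T\beta=1,\quad \mathbf j^TL=\mathbf 0,\quad W_c\beta=\lambda\mathbf j,\quad W_cL+I=\mathbf j\alpha^T,$$ and $L$ is Laplacian-like, that is, $L\mathbf j=\mathbf 0$ and $\mathbf j^TL=\mathbf 0$. Furthermore, if $\lambda$ is invertible in $R$, then $W_c$ is invertible and $W_c^{-1}=-L+\frac1\lambda\beta\alpha^T$. -/

import Mathlib

open scoped Matrix Classical

noncomputable section

namespace CactoidDistance

universe u v

/-! ### Digraphs, subdigraphs, cut vertices and blocks -/

section Graph

variable {V : Type u}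

/-- A digraph is strongly connected if it has a vertex and every vertex can be reached from every
vertex along arcs. -/
def StronglyConnected (G : Digraph V) : Prop :=
  Nonempty V ∧ ∀ a b : V, Relation.ReflTransGen G.Adj a b

/-- A subdigraph of `G`: a set of vertices of `G` and a set of arcs of `G` between them. -/
@[ext]
structure Subdigraph (G : Digraph V) where
  verts : Set V
  Adj : V → V → Prop
  adj_sub : ∀ {a b : V}, Adj a b → G.Adj a b
  fst_mem : ∀ {a b : V}, Adj a b → a ∈ verts
  snd_mem : ∀ {a b : V}, Adj a b → b ∈ verts

namespace Subdigraph

variable {G : Digraph V}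

/-- Inclusion of subdigraphs, on vertices and on arcs. -/
instance : LE (Subdigraph G) :=
  ⟨fun H K => H.verts ⊆ K.verts ∧ ∀ a b : V, H.Adj a b → K.Adj a b⟩

/-- Deletion of the vertex `x`, together with all arcs at `x`. -/
def deleteVert (H : Subdigraph G) (x : V) : Subdigraph G where
  verts := H.verts \ {x}
  Adj a b := H.Adj a b ∧ a ≠ x ∧ b ≠ x
  adj_sub h := H.adj_sub h.1
  fst_mem h := ⟨H.fst_mem h.1, h.2.1⟩
  snd_mem h := ⟨H.snd_mem h.1, h.2.2⟩

/-- A subdigraph is disconnected if two of its vertices cannot be joined even when the directions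
of the arcs are ignored. -/
def Disconnected (H : Subdigraph G) : Prop :=
  ∃ a ∈ H.verts, ∃ b ∈ H.verts,
    ¬ Relation.ReflTransGen (fun x y => H.Adj x y ∨ H.Adj y x) a b

/-- A cut vertex: a vertex whose deletion results in a disconnected digraph. -/
def IsCutVertex (H : Subdigraph G) (x : V) : Prop :=
  x ∈ H.verts ∧ (H.deleteVert x).Disconnected

/-- Strong connectedness of a subdigraph with at least one vertex, by means of its own arcs. -/
def StronglyConnected (H : Subdigraph G) : Prop :=
  H.verts.Nonempty ∧ ∀ a ∈ H.verts, ∀ b ∈ H.verts, Relation.ReflTransGen H.Adj a b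

/-- A block: a strongly connected subdigraph on at least two vertices that has no cut vertex, and
is maximal with these properties. -/
def IsBlock (H : Subdigraph G) : Prop :=
  Maximal (fun K : Subdigraph G =>
    K.StronglyConnected ∧ K.verts.Nontrivial ∧ ∀ x, ¬ K.IsCutVertex x) H

/-- `e` identifies `H` with the directed cycle on `ℤ/n`, whose arcs are the pairs `(k, k + 1)`. -/
def IsCycleLabelling (H : Subdigraph G) (n : ℕ) (e : ZMod n ≃ H.verts) : Prop :=
  2 ≤ n ∧ ∀ k l : ZMod n, H.Adj (e k) (e l) ↔ l = k + 1

end Subdigraph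

/-- A cactoid digraph: a strongly connected digraph, each block of which is a directed cycle
(of length at least two). -/
def IsCactoid (G : Digraph V) : Prop :=
  StronglyConnected G ∧
    ∀ H : Subdigraph G, H.IsBlock → ∃ (n : ℕ) (e : ZMod n ≃ H.verts), H.IsCycleLabelling n e

/-- Directed walks in `G`. -/
inductive Walk (G : Digraph V) : V → V → Type u
  | nil (a : V) : Walk G a a
  | cons {a b c : V} (h : G.Adj a b) (p : Walk G b c) : Walk G a c

namespace Walk

variable {G : Digraph V}

/-- The number of arcs of a walk. -/
def length : {a b : V} → Walk G a b → ℕ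
  | _, _, nil _ => 0
  | _, _, cons _ p => p.length + 1

/-- The sum of the weights of the arcs of a walk; the arc from `a` to `b` has the weight
`w a b`. -/
def weight {R : Type v} [CommRing R] (w : V → V → R) : {a b : V} → Walk G a b → R
  | _, _, nil _ => 0
  | _, _, @cons _ _ a b _ _ p => w a b + p.weight w

/-- A shortest directed walk (necessarily a directed path) between its ends. -/
def IsShortest {a b : V} (p : Walk G a b) : Prop :=
  ∀ q : Walk G a b, p.length ≤ q.length

end Walk

/-- The distance matrix of a weighted digraph: the entry at `(a, b)` is the sum of the weights of
the arcs of a shortest directed path from `a` to `b`. In a cactoid digraph it is the same for every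
choice of the shortest paths. -/
def distMatrix {R : Type v} [CommRing R] (G : Digraph V) (w : V → V → R) : Matrix V V R :=
  fun a b => if h : ∃ p : Walk G a b, p.IsShortest then h.choose.weight w else 0

end Graph

/-! ### Bags -/

section Bags

variable {R : Type v} [CommRing R]

/-- A bag on the index set `X`: square matrices `A` and `L`, a number `lam` and column vectors
`α` and `β`. -/
structure Bag (R : Type v) (X : Type u) where
  A : Matrix X X R
  lam : R
  α : X → R
  β : X → R
  L : Matrix X X R

/-- The bag obtained by renaming the indices along a bijection. -/
def Bag.reindex {X Y : Type*} (B : Bag R X) (e : X ≃ Y) : Bag R Y where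
  A := B.A.submatrix e.symm e.symm
  lam := B.lam
  α := B.α ∘ e.symm
  β := B.β ∘ e.symm
  L := B.L.submatrix e.symm e.symm

variable {X : Type u} [Fintype X]

/-- `αᵀ j = 1`, `L j = 0`, `αᵀ A = λ jᵀ` and `L A + I = β jᵀ`, with `j` the all-ones vector. -/
def Bag.IsLeftLapExp [DecidableEq X] (B : Bag R X) : Prop :=
  B.α ⬝ᵥ 1 = 1 ∧ B.L *ᵥ 1 = 0 ∧ B.α ᵥ* B.A = B.lam • 1 ∧
    B.L * B.A + 1 = Matrix.vecMulVec B.β 1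

/-- `jᵀ β = 1`, `jᵀ L = 0`, `A β = λ j` and `A L + I = j αᵀ`, with `j` the all-ones vector. -/
def Bag.IsRightLapExp [DecidableEq X] (B : Bag R X) : Prop :=
  1 ⬝ᵥ B.β = 1 ∧ 1 ᵥ* B.L = 0 ∧ B.A *ᵥ B.β = B.lam • 1 ∧
    B.A * B.L + 1 = Matrix.vecMulVec 1 B.α

/-- `L j = 0` and `jᵀ L = 0`. -/
def IsLaplacianLike (L : Matrix X X R) : Prop :=
  L *ᵥ 1 = 0 ∧ 1 ᵥ* L = 0

/-! ### The natural bag of a weighted directed cycle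

The arc `(k, k + 1)` of the directed cycle on `ℤ/n` carries the weight `w k`. -/

/-- The first weight `∑_{0 ≤ i ≤ n-1} w i`. -/
def firstWeight (n : ℕ) (w : ZMod n → R) : R :=
  ∑ i ∈ Finset.range n, w (i : ZMod n)

/-- The second weight `∑_{0 ≤ i < j ≤ n-1} w i * w j`. -/
def secondWeight (n : ℕ) (w : ZMod n → R) : R :=
  ∑ j ∈ Finset.range n, ∑ i ∈ Finset.range j, w (i : ZMod n) * w (j : ZMod n)

/-- The distance matrix of the weighted directed cycle: the `(k, l)` entry is the sum of the
weights of the arcs met when going from `k` to `l`. -/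
def cycleDist (n : ℕ) (w : ZMod n → R) : Matrix (ZMod n) (ZMod n) R :=
  fun k l => ∑ i ∈ Finset.range (l - k).val, w (k + (i : ZMod n))

/-- The cyclic permutation matrix, with ones exactly at the entries `(k, k + 1)`. -/
def cyclicPerm (R : Type v) [CommRing R] (n : ℕ) : Matrix (ZMod n) (ZMod n) R :=
  fun k l => if l = k + 1 then 1 else 0

/-- The natural bag of a weighted directed cycle (meant for an invertible first weight, whose
inverse is then `Ring.inverse`). -/
def naturalBag (n : ℕ) (w : ZMod n → R) : Bag R (ZMod n) where
  A := cycleDist n w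
  lam := secondWeight n w * Ring.inverse (firstWeight n w)
  α := fun k => Ring.inverse (firstWeight n w) * w (k - 1)
  β := fun k => Ring.inverse (firstWeight n w) * w k
  L := Ring.inverse (firstWeight n w) • (1 - cyclicPerm R n)

/-! ### The composition bag -/

variable {V : Type u} {r : ℕ}

/-- The set of all indices `i` such that `x` is a vertex of the `i`-th block, where `S i` is the
set of vertices of the `i`-th block. -/
def blockIndexSet (S : Fin r → Set V) (x : V) : Finset (Fin r) :=
  Finset.univ.filter fun i => x ∈ S i

/-- Extension by zero of a vector indexed by a set of vertices. -/
def extendVec {S : Set V} (f : S → R) : V → R :=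
  fun x => if h : x ∈ S then f ⟨x, h⟩ else 0

/-- Extension by zero of a matrix indexed by a set of vertices. -/
def extendMat {S : Set V} (M : Matrix S S R) : Matrix V V R :=
  fun x y => if h : x ∈ S ∧ y ∈ S then M ⟨x, h.1⟩ ⟨y, h.2⟩ else 0

/-- The composition bag of bags `B i` on the vertex sets `S i` of the blocks, with the given matrix
`D` (whose restriction to each block is to be the matrix of the bag of that block). -/
def compositionBag (D : Matrix V V R) (S : Fin r → Set V) (B : ∀ i, Bag R (S i)) : Bag R V where
  A := D
  lam := ∑ i, (B i).lam
  α := fun x =>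
    ∑ i ∈ blockIndexSet S x, extendVec (B i).α x - ((blockIndexSet S x).card : R) + 1
  β := fun x =>
    ∑ i ∈ blockIndexSet S x, extendVec (B i).β x - ((blockIndexSet S x).card : R) + 1
  L := ∑ i, extendMat (B i).L

/-- The weights along a labelled cycle of a weighted digraph: the arc from the vertex labelled `k`
to the vertex labelled `k + 1` has its weight in the digraph. -/
def cycleWeight {S : Set V} {n : ℕ} (w : V → V → R) (e : ZMod n ≃ S) : ZMod n → R :=
  fun k => w (e k) (e (k + 1))

/-- The natural bag of a labelled cycle of a weighted digraph, indexed by the vertices of the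
cycle. -/
def naturalBlockBag {S : Set V} {n : ℕ} (w : V → V → R) (e : ZMod n ≃ S) : Bag R S :=
  (naturalBag n (cycleWeight w e)).reindex e

end Bags

end CactoidDistance

end

/-!
The proof does not remove the blocks one by one; it computes with *gates*.

Let `S` be the vertex set of a block. A directed path with both ends in `S` stays in the block,
since adding it to the block preserves strong connectedness and creates no cut vertex
(`Subdigraph.IsBlock.adj_of_path`). Hence every vertex `v` has a gate in `S`: every walk from `S`
to `v` leaves `S` for the last time at the gate, and every walk from `v` to `S` enters `S` there
(`ExitsAt.eq_of_entersAt`). If `u ≠ v`, there is exactly one block at `u` in which the gate of `v`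
is not `u`, the block that contains the first arc of a path from `u` to `v` (`gate_ne_of_adj`,
`gate_eq_of_not_adj`). As a block is a cycle, that first arc is determined by `u` and `v`, so the
shortest walk is unique, and the distances are additive at the gates (`isGatedMatrix_distMatrix`).

Fix a vertex `v`. Counting the blocks at `x` by whether `x` is the gate of `v` turns the correction
`-b(x) + 1` in the composition into a sum over the blocks,
`f(x) = [x = v] + ∑ i, (f i x - [x = gate of v in block i])`
(`IsGatedMatrix.sum_sub_card_add_one`). With additivity at the gates, this reduces every identity
for the composition to the same identity for the single bags, one block at a time
(`IsGatedMatrix.isLeftLapExp`); the right-hand identities follow by transposition.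

For a single cycle, `L A + I = β jᵀ` and `A L + I = j αᵀ` are direct computations. They force `A β`
and `αᵀ A` to be constant, with common value `αᵀ A β`, and the entry of `A β` at `0` is `λ` by the
definition of the second weight. The inverse formula follows from `A L + I = j αᵀ` and
`A β = λ j`.
-/

namespace CactoidDistance

open Relation

/-! ### Compositions of bags along gates -/

section Algebra

variable {R : Type*} [CommRing R]

/-- The bag with both matrices transposed and the two vectors interchanged. -/
def Bag.transpose {X : Type*} (B : Bag R X) : Bag R X where
  A := B.Aᵀ
  lam := B.lam
  α := B.β
  β := B.α
  L := B.Lᵀ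

theorem Bag.isLeftLapExp_transpose {X : Type*} [Fintype X] [DecidableEq X] {B : Bag R X} :
    B.transpose.IsLeftLapExp ↔ B.IsRightLapExp := by
  have h : B.Lᵀ * B.Aᵀ + 1 = Matrix.vecMulVec B.α 1 ↔
      B.A * B.L + 1 = Matrix.vecMulVec 1 B.α := by
    rw [← Matrix.transpose_inj]
    simp [Matrix.transpose_mul]
  simp only [Bag.IsLeftLapExp, Bag.IsRightLapExp, Bag.transpose, h, Matrix.mulVec_transpose,
    Matrix.vecMul_transpose, dotProduct_comm B.β]

theorem Bag.IsLeftLapExp.reindex {X Y : Type*} [Fintype X] [DecidableEq X] [Fintype Y]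
    [DecidableEq Y] {B : Bag R X} (hB : B.IsLeftLapExp) (e : X ≃ Y) :
    (B.reindex e).IsLeftLapExp := by
  obtain ⟨h1, h2, h3, h4⟩ := hB
  refine ⟨?_, ?_, ?_, ?_⟩
  · rw [← h1]
    exact Fintype.sum_equiv e.symm _ _ fun _ => rfl
  · funext y
    refine Eq.trans ?_ (congrFun h2 (e.symm y))
    exact Fintype.sum_equiv e.symm _ _ fun _ => rfl
  · funext y
    rw [show (B.reindex e).lam • (1 : Y → R) = fun _ => B.lam * 1 from rfl,
      ← show _ = B.lam * 1 from congrFun h3 (e.symm y)]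
    exact Fintype.sum_equiv e.symm _ _ fun _ => rfl
  · have h := congrArg (fun M => Matrix.submatrix M e.symm e.symm) h4
    simp only [Matrix.submatrix_add, Pi.add_apply, Matrix.submatrix_one_equiv] at h
    rw [← Matrix.submatrix_mul_equiv _ _ _ e.symm] at h
    exact h

theorem Bag.IsRightLapExp.reindex {X Y : Type*} [Fintype X] [DecidableEq X] [Fintype Y]
    [DecidableEq Y] {B : Bag R X} (hB : B.IsRightLapExp) (e : X ≃ Y) :
    (B.reindex e).IsRightLapExp :=
  Bag.isLeftLapExp_transpose.1
    ((Bag.isLeftLapExp_transpose.2 hB).reindex e : (B.transpose.reindex e).IsLeftLapExp)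

/-- From `A L + I = j αᵀ` and `A β = λ j` one reads off a right inverse of `A`. -/
theorem Bag.IsRightLapExp.mul_eq_one {X : Type*} [Fintype X] [DecidableEq X] {B : Bag R X}
    (hB : B.IsRightLapExp) (hlam : IsUnit B.lam) :
    B.A * (-B.L + Ring.inverse B.lam • Matrix.vecMulVec B.β B.α) = 1 := by
  obtain ⟨-, -, h3, h4⟩ := hB
  rw [mul_add, mul_neg, Matrix.mul_smul, Matrix.mul_vecMulVec, h3, Matrix.smul_vecMulVec,
    smul_smul, Ring.inverse_mul_cancel _ hlam, one_smul, ← h4]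
  abel

variable {V : Type*}

theorem sum_extendVec_mul [Fintype V] {S : Set V} [Fintype S] (f : S → R) (h : V → R) :
    ∑ x, extendVec f x * h x = ∑ x : S, f x * h x := by
  rw [← Finset.sum_subset (Finset.subset_univ S.toFinset)
    (fun x _ hx => by simp [extendVec, Set.mem_toFinset.not.1 hx]), ← Finset.sum_set_coe]
  exact Finset.sum_congr rfl fun x _ => by simp [extendVec]

theorem extendMat_apply_of_mem {S : Set V} (M : Matrix S S R) (u : S) :
    extendMat M (u : V) = extendVec (M u) := by
  funext y
  simp [extendMat, extendVec]

/-- A tree-like system of subsets `S i`: every vertex `v` has a gate `g i v` in every `S i`, and for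
`u ≠ v` there is exactly one set `S i` through which one leaves `u` on the way to `v`. The matrix
`D` is additive at the gates. -/
structure IsGatedMatrix {r : ℕ} (D : Matrix V V R) (S : Fin r → Set V) (g : Fin r → V → V) :
    Prop where
  gate_mem : ∀ i v, g i v ∈ S i
  gate_self : ∀ i, ∀ v ∈ S i, g i v = v
  unique_exit : ∀ u v, u ≠ v → ∃! i, u ∈ S i ∧ g i v ≠ u
  apply_self : ∀ v, D v v = 0
  split_left : ∀ i v, ∀ x ∈ S i, D x v = D x (g i v) + D (g i v) v
  split_right : ∀ i v, ∀ x ∈ S i, D v x = D v (g i v) + D (g i v) x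

variable {r : ℕ} {D : Matrix V V R} {S : Fin r → Set V} {g : Fin r → V → V}

theorem IsGatedMatrix.transpose (h : IsGatedMatrix D S g) : IsGatedMatrix Dᵀ S g where
  gate_mem := h.gate_mem
  gate_self := h.gate_self
  unique_exit := h.unique_exit
  apply_self := h.apply_self
  split_left i v x hx := (h.split_right i v x hx).trans (add_comm _ _)
  split_right i v x hx := (h.split_left i v x hx).trans (add_comm _ _)

/-- The correction term `-b(x) + 1` in the composition, seen from a fixed vertex `v`: apart from
`v` itself, `x` is the gate of `v` in all sets that contain `x`, except one. -/
theorem IsGatedMatrix.sum_sub_card_add_one [DecidableEq V] (h : IsGatedMatrix D S g)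
    (f : ∀ i, S i → R) (v x : V) :
    ∑ i ∈ blockIndexSet S x, extendVec (f i) x - ((blockIndexSet S x).card : R) + 1 =
      (if x = v then 1 else 0) +
        ∑ i, (extendVec (f i) x - if x = g i v then 1 else 0) := by
  have h1 : ∑ i ∈ blockIndexSet S x, extendVec (f i) x = ∑ i, extendVec (f i) x := by
    refine Finset.sum_subset (Finset.subset_univ _) fun i _ hi => ?_
    have : x ∉ S i := by simpa [blockIndexSet] using hi
    simp [extendVec, this]
  have h2 : ((blockIndexSet S x).card : R) + (if x = v then 1 else 0) =
      ∑ i, (if x = g i v then 1 else 0) + 1 := by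
    have hsub : ∀ i, x = g i v → x ∈ S i := fun i hi => hi ▸ h.gate_mem i v
    rw [Finset.sum_boole]
    split_ifs with hxv
    · subst hxv
      congr 2
      refine congrArg _ (Finset.ext fun i => ?_)
      simpa [blockIndexSet] using
        ⟨fun hi => (h.gate_self i _ hi).symm, hsub i⟩
    · obtain ⟨k, ⟨hk, hgk⟩, huniq⟩ := h.unique_exit x v hxv
      have : blockIndexSet S x = insert k (Finset.univ.filter fun i => x = g i v) := by
        ext i
        simp only [blockIndexSet, Finset.mem_filter, Finset.mem_univ, true_and,
          Finset.mem_insert]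
        constructor
        · intro hi
          by_contra! hc
          exact hc.1 (huniq i ⟨hi, hc.2.symm⟩)
        · rintro (rfl | hi)
          exacts [hk, hsub i hi]
      rw [this, Finset.card_insert_of_notMem (by simpa using hgk.symm)]
      push_cast
      ring
  rw [h1, Finset.sum_sub_distrib]
  linear_combination -h2

variable {B : ∀ i, Bag R (S i)}

theorem compositionBag_transpose :
    (compositionBag D S B).transpose = compositionBag Dᵀ S fun i => (B i).transpose := by
  have : (∑ i, extendMat (B i).L)ᵀ = ∑ i, extendMat (B i).Lᵀ := by
    rw [Matrix.transpose_sum]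
    refine Finset.sum_congr rfl fun i _ => ?_
    ext x y
    simp only [Matrix.transpose_apply, extendMat, and_comm]
  simp only [compositionBag, Bag.transpose, this]

/-- The expansion at `v` (any vertex in the first identity) of `sum_sub_card_add_one` turns each
identity for the composition into the sum over `i` of the same identity for `B i`, read at the gate
of `v`. -/
theorem IsGatedMatrix.isLeftLapExp [Fintype V] [Nonempty V] [DecidableEq V]
    (h : IsGatedMatrix D S g) (hA : ∀ i, (B i).A = D.submatrix Subtype.val Subtype.val)
    (hB : ∀ i, (B i).IsLeftLapExp) :
    (compositionBag D S B).IsLeftLapExp := by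
  have hα := fun v x => h.sum_sub_card_add_one (fun i => (B i).α) v x
  have hβ := fun v x => h.sum_sub_card_add_one (fun i => (B i).β) v x
  refine ⟨?_, ?_, ?_, ?_⟩
  · obtain ⟨v⟩ := ‹Nonempty V›
    simp only [dotProduct, compositionBag, hα v, Pi.one_apply, mul_one, Finset.sum_add_distrib]
    rw [Finset.sum_comm]
    have h1 : ∀ i, ∑ x, extendVec (B i).α x = 1 := fun i => by
      have := sum_extendVec_mul (B i).α 1
      simp only [Pi.one_apply, mul_one] at this
      rw [this, ← (hB i).1]
      simp [dotProduct]
    simp [Finset.sum_sub_distrib, h1]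
  · simp only [compositionBag, Matrix.sum_mulVec]
    refine Finset.sum_eq_zero fun i _ => funext fun u => ?_
    by_cases hu : u ∈ S i
    · have := sum_extendVec_mul ((B i).L ⟨u, hu⟩) 1
      rw [← extendMat_apply_of_mem] at this
      exact this.trans (congrFun (hB i).2.1 ⟨u, hu⟩)
    · simp [Matrix.mulVec, dotProduct, extendMat, hu]
  · funext v
    simp only [Matrix.vecMul, dotProduct, compositionBag, hα v, Pi.smul_apply, Pi.one_apply,
      smul_eq_mul, mul_one, add_mul, Finset.sum_add_distrib, Finset.sum_mul, sub_mul]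
    rw [Finset.sum_comm]
    simp only [ite_mul, one_mul, zero_mul, Finset.sum_ite_eq', Finset.mem_univ, if_true,
      h.apply_self, zero_add]
    refine Finset.sum_congr rfl fun i _ => ?_
    have h1 : ∑ x : S i, (B i).α x = 1 := by simpa [dotProduct] using (hB i).1
    have h3 : ∑ x : S i, (B i).α x * D x (g i v) = (B i).lam := by
      have := congrFun (hB i).2.2.1 ⟨g i v, h.gate_mem i v⟩
      simpa [Matrix.vecMul, dotProduct, hA] using this
    rw [Finset.sum_sub_distrib, sum_extendVec_mul _ fun x => D x v,
      Finset.sum_congr rfl fun (x : S i) _ => by rw [h.split_left i v x x.2, mul_add],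
      Finset.sum_add_distrib, h3, ← Finset.sum_mul, h1]
    simp
  · ext u v
    simp only [compositionBag, Matrix.add_apply, Matrix.one_apply, Matrix.vecMulVec_apply, hβ v,
      Pi.one_apply, mul_one, Matrix.sum_mul, Matrix.sum_apply]
    rw [add_comm]
    refine congrArg₂ _ rfl (Finset.sum_congr rfl fun i _ => ?_)
    by_cases hu : u ∈ S i
    · have h2 : ∑ x : S i, (B i).L ⟨u, hu⟩ x = 0 := by
        simpa [Matrix.mulVec, dotProduct] using congrFun (hB i).2.1 ⟨u, hu⟩
      have h4 := congrFun (congrFun (hB i).2.2.2 ⟨u, hu⟩) ⟨g i v, h.gate_mem i v⟩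
      simp only [Matrix.add_apply, Matrix.mul_apply, hA, Matrix.submatrix_apply, Matrix.one_apply,
        Matrix.vecMulVec_apply, Pi.one_apply, mul_one, Subtype.mk.injEq] at h4
      have := sum_extendVec_mul ((B i).L ⟨u, hu⟩) fun x => D x v
      rw [← extendMat_apply_of_mem, Finset.sum_congr rfl fun (x : S i) _ => by
        rw [h.split_left i v x x.2, mul_add], Finset.sum_add_distrib, ← Finset.sum_mul, h2,
        zero_mul, add_zero] at this
      rw [Matrix.mul_apply, this, eq_sub_iff_add_eq, extendVec, dif_pos hu, ← h4]
    · have hg : u ≠ g i v := fun hc => hu (hc ▸ h.gate_mem i v)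
      simp [Matrix.mul_apply, extendMat, extendVec, hu, hg]

theorem IsGatedMatrix.isRightLapExp [Fintype V] [Nonempty V] [DecidableEq V]
    (h : IsGatedMatrix D S g) (hA : ∀ i, (B i).A = D.submatrix Subtype.val Subtype.val)
    (hB : ∀ i, (B i).IsRightLapExp) :
    (compositionBag D S B).IsRightLapExp := by
  rw [← Bag.isLeftLapExp_transpose, compositionBag_transpose]
  exact h.transpose.isLeftLapExp (fun i => by simp [Bag.transpose, hA])
    fun i => Bag.isLeftLapExp_transpose.2 (hB i)

end Algebra

/-! ### The natural bag of a directed cycle -/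

section Cycle

variable {R : Type*} [CommRing R] {n : ℕ} [NeZero n]

theorem sum_zmod_eq_sum_range (k : ZMod n) (f : ZMod n → R) :
    ∑ l, f l = ∑ i ∈ Finset.range n, f (k + (i : ZMod n)) := by
  rw [← Equiv.sum_comp (Equiv.addLeft k)]
  refine (Finset.sum_bij' (fun (i : ℕ) _ => (i : ZMod n)) (fun l _ => l.val) ?_ ?_ ?_ ?_ ?_).symm
  · simp
  · exact fun l _ => Finset.mem_range.2 l.val_lt
  · exact fun i hi => ZMod.val_cast_of_lt (Finset.mem_range.1 hi)
  · exact fun l _ => ZMod.natCast_zmod_val l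
  · simp

theorem firstWeight_eq_sum (w : ZMod n → R) : firstWeight n w = ∑ k, w k := by
  simp [sum_zmod_eq_sum_range 0 w, firstWeight]

theorem cycleDist_self {m : ℕ} (w : ZMod m → R) (k : ZMod m) : cycleDist m w k k = 0 := by
  simp [cycleDist]

theorem val_sub_eq_succ {k l : ZMod n} (h : k ≠ l) : (l - k).val = (l - (k + 1)).val + 1 := by
  have hpos : (l - k).val ≠ 0 := fun hc => h (sub_eq_zero.1 ((ZMod.val_eq_zero _).1 hc)).symm
  obtain ⟨t, ht⟩ := Nat.exists_eq_succ_of_ne_zero hpos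
  have hlt := ZMod.val_lt (l - k)
  have : l - (k + 1) = (t : ZMod n) := by
    have := ZMod.natCast_zmod_val (l - k)
    rw [ht] at this
    push_cast at this
    rw [← sub_sub, ← this]
    ring
  rw [this, ZMod.val_cast_of_lt (by omega), ht]

theorem cycleDist_of_ne (w : ZMod n → R) {k l : ZMod n} (h : k ≠ l) :
    cycleDist n w k l = w k + cycleDist n w (k + 1) l := by
  unfold cycleDist
  rw [val_sub_eq_succ h, Finset.sum_range_succ', add_comm]
  simp [add_assoc, add_comm (1 : ZMod n)]

theorem cycleDist_add_one_self (w : ZMod n → R) (k : ZMod n) :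
    w k + cycleDist n w (k + 1) k = firstWeight n w := by
  obtain ⟨m, rfl⟩ := Nat.exists_eq_succ_of_ne_zero (NeZero.ne n)
  have : (k - (k + 1)).val = m := by
    rw [sub_add_cancel_left, ZMod.val_neg_one]
  rw [firstWeight_eq_sum, sum_zmod_eq_sum_range k, Finset.sum_range_succ', cycleDist, this,
    add_comm]
  simp [add_assoc, add_comm (1 : ZMod (m + 1))]

theorem cycleDist_sub_cycleDist_add_one (w : ZMod n → R) (k l : ZMod n) :
    cycleDist n w k l - cycleDist n w (k + 1) l = w k - if k = l then firstWeight n w else 0 := by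
  split_ifs with h
  · subst h
    rw [cycleDist_self, ← cycleDist_add_one_self w k]
    ring
  · rw [cycleDist_of_ne w h]
    ring

theorem cycleDist_add_one_right (w : ZMod n → R) {k l : ZMod n} (h : k ≠ l + 1) :
    cycleDist n w k (l + 1) = cycleDist n w k l + w l := by
  have hv : (l + 1 - k).val = (l - k).val + 1 := by
    rw [val_sub_eq_succ h]
    congr 2
    ring
  unfold cycleDist
  rw [hv, Finset.sum_range_succ, ZMod.natCast_zmod_val]
  congr 2
  ring

theorem cycleDist_sub_cycleDist_sub_one (w : ZMod n → R) (k l : ZMod n) :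
    cycleDist n w k l - cycleDist n w k (l - 1) =
      w (l - 1) - if k = l then firstWeight n w else 0 := by
  obtain ⟨l, rfl⟩ : ∃ l', l = l' + 1 := ⟨l - 1, by ring⟩
  rw [add_sub_cancel_right]
  split_ifs with h
  · subst h
    rw [cycleDist_self, ← cycleDist_add_one_self w l]
    ring
  · rw [cycleDist_add_one_right w h]
    ring

theorem eq_of_forall_eq_add_one {T : Type*} {x : ZMod n → T} (h : ∀ k, x k = x (k + 1))
    (k : ZMod n) : x k = x 0 := by
  have : ∀ t : ℕ, x (t : ZMod n) = x 0 := fun t => by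
    induction t with
    | zero => simp
    | succ t ih => rw [Nat.cast_succ, ← h, ih]
  rw [← ZMod.natCast_zmod_val k, this]

variable {w : ZMod n → R}

theorem cyclicPerm_mul_apply (M : Matrix (ZMod n) (ZMod n) R) (k l : ZMod n) :
    (cyclicPerm R n * M) k l = M (k + 1) l := by
  simp [cyclicPerm, Matrix.mul_apply]

theorem mul_cyclicPerm_apply (M : Matrix (ZMod n) (ZMod n) R) (k l : ZMod n) :
    (M * cyclicPerm R n) k l = M k (l - 1) := by
  have : ∀ m : ZMod n, l = m + 1 ↔ m = l - 1 := fun m => by rw [eq_sub_iff_add_eq, eq_comm]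
  simp [cyclicPerm, Matrix.mul_apply, this]

theorem naturalBag_L_mul_A (hw : IsUnit (firstWeight n w)) :
    (naturalBag n w).L * (naturalBag n w).A + 1 = Matrix.vecMulVec (naturalBag n w).β 1 := by
  ext k l
  simp only [naturalBag, Matrix.smul_mul, sub_mul, one_mul, Matrix.add_apply, Matrix.smul_apply,
    Matrix.sub_apply, cyclicPerm_mul_apply, cycleDist_sub_cycleDist_add_one, smul_eq_mul,
    Matrix.vecMulVec_apply, Pi.one_apply, mul_one, mul_sub, Matrix.one_apply]
  split_ifs <;> simp [Ring.inverse_mul_cancel _ hw]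

theorem naturalBag_A_mul_L (hw : IsUnit (firstWeight n w)) :
    (naturalBag n w).A * (naturalBag n w).L + 1 = Matrix.vecMulVec 1 (naturalBag n w).α := by
  ext k l
  simp only [naturalBag, Matrix.mul_smul, mul_sub, mul_one, Matrix.add_apply, Matrix.smul_apply,
    Matrix.sub_apply, mul_cyclicPerm_apply, cycleDist_sub_cycleDist_sub_one, smul_eq_mul,
    Matrix.vecMulVec_apply, Pi.one_apply, one_mul, Matrix.one_apply]
  split_ifs <;> simp [Ring.inverse_mul_cancel _ hw]

theorem naturalBag_L_mulVec (x : ZMod n → R) (k : ZMod n) :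
    ((naturalBag n w).L *ᵥ x) k = Ring.inverse (firstWeight n w) * (x k - x (k + 1)) := by
  simp [naturalBag, cyclicPerm, Matrix.mulVec, dotProduct, Matrix.one_apply, mul_sub, sub_mul]

theorem naturalBag_vecMul_L (x : ZMod n → R) (k : ZMod n) :
    (x ᵥ* (naturalBag n w).L) k = Ring.inverse (firstWeight n w) * (x k - x (k - 1)) := by
  have : ∀ m : ZMod n, k = m + 1 ↔ m = k - 1 := fun m => by rw [eq_sub_iff_add_eq, eq_comm]
  simp [naturalBag, cyclicPerm, Matrix.vecMul, dotProduct, this, Matrix.one_apply, mul_sub]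
  ring

theorem naturalBag_one_dotProduct_β (hw : IsUnit (firstWeight n w)) :
    1 ⬝ᵥ (naturalBag n w).β = 1 := by
  simp [naturalBag, dotProduct, ← Finset.mul_sum, ← firstWeight_eq_sum,
    Ring.inverse_mul_cancel _ hw]

theorem naturalBag_α_dotProduct_one (hw : IsUnit (firstWeight n w)) :
    (naturalBag n w).α ⬝ᵥ 1 = 1 := by
  have : ∑ k : ZMod n, w (k - 1) = ∑ k, w k := Equiv.sum_comp (Equiv.subRight 1) w
  simp [naturalBag, dotProduct, ← Finset.mul_sum, this, ← firstWeight_eq_sum,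
    Ring.inverse_mul_cancel _ hw]

/-- Since `L A β + β = β jᵀ β = β`, the vector `A β` lies in the kernel of `L`, so it is constant;
its entry at `0` is the definition of the second weight. -/
theorem naturalBag_A_mulVec_β (hw : IsUnit (firstWeight n w)) :
    (naturalBag n w).A *ᵥ (naturalBag n w).β = (naturalBag n w).lam • 1 := by
  have hL : (naturalBag n w).L *ᵥ ((naturalBag n w).A *ᵥ (naturalBag n w).β) = 0 := by
    have := congrArg (· *ᵥ (naturalBag n w).β) (naturalBag_L_mul_A hw)
    simp only [Matrix.add_mulVec, Matrix.one_mulVec, ← Matrix.mulVec_mulVec,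
      Matrix.vecMulVec_mulVec, naturalBag_one_dotProduct_β hw, MulOpposite.op_one,
      one_smul] at this
    simpa using this
  have hconst := eq_of_forall_eq_add_one (x := (naturalBag n w).A *ᵥ (naturalBag n w).β)
    fun k => by
      have := congrFun hL k
      rw [naturalBag_L_mulVec] at this
      rw [← sub_eq_zero, ← one_mul (_ - _), ← Ring.mul_inverse_cancel _ hw, mul_assoc, this]
      simp
  funext k
  rw [hconst k]
  simp only [Matrix.mulVec, dotProduct, naturalBag, Pi.smul_apply, Pi.one_apply, smul_eq_mul,
    mul_one, secondWeight]
  rw [sum_zmod_eq_sum_range 0, Finset.sum_mul]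
  refine Finset.sum_congr rfl fun j hj => ?_
  simp only [cycleDist, zero_add, sub_zero, ZMod.val_cast_of_lt (Finset.mem_range.1 hj),
    ← Finset.sum_mul]
  ring

/-- As `αᵀ A L + αᵀ = αᵀ j αᵀ = αᵀ`, the vector `αᵀ A` is constant; the constant is
`αᵀ A β = λ`. -/
theorem naturalBag_α_vecMul_A (hw : IsUnit (firstWeight n w)) :
    (naturalBag n w).α ᵥ* (naturalBag n w).A = (naturalBag n w).lam • 1 := by
  have hL : ((naturalBag n w).α ᵥ* (naturalBag n w).A) ᵥ* (naturalBag n w).L = 0 := by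
    have := congrArg ((naturalBag n w).α ᵥ* ·) (naturalBag_A_mul_L hw)
    simp only [Matrix.vecMul_add, Matrix.vecMul_one, ← Matrix.vecMul_vecMul,
      Matrix.vecMul_vecMulVec, naturalBag_α_dotProduct_one hw, one_smul] at this
    simpa using this
  have hconst := eq_of_forall_eq_add_one (x := (naturalBag n w).α ᵥ* (naturalBag n w).A)
    fun k => by
      have := congrFun hL (k + 1)
      rw [naturalBag_vecMul_L, add_sub_cancel_right] at this
      symm
      rw [← sub_eq_zero, ← one_mul (_ - _), ← Ring.mul_inverse_cancel _ hw, mul_assoc, this]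
      simp
  have hsmul : (naturalBag n w).α ᵥ* (naturalBag n w).A =
      ((naturalBag n w).α ᵥ* (naturalBag n w).A) 0 • 1 := funext fun k => by simp [hconst k]
  have h := Matrix.dotProduct_mulVec (naturalBag n w).α (naturalBag n w).A (naturalBag n w).β
  rw [naturalBag_A_mulVec_β hw, dotProduct_smul, naturalBag_α_dotProduct_one hw, hsmul,
    smul_dotProduct, naturalBag_one_dotProduct_β hw, smul_eq_mul, smul_eq_mul, mul_one,
    mul_one] at h
  rw [hsmul, ← h]

theorem naturalBag_isLeftLapExp (hw : IsUnit (firstWeight n w)) :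
    (naturalBag n w).IsLeftLapExp := by
  refine ⟨naturalBag_α_dotProduct_one hw, funext fun k => ?_, naturalBag_α_vecMul_A hw, ?_⟩
  · simp [naturalBag_L_mulVec]
  · convert naturalBag_L_mul_A hw

theorem naturalBag_isRightLapExp (hw : IsUnit (firstWeight n w)) :
    (naturalBag n w).IsRightLapExp := by
  refine ⟨naturalBag_one_dotProduct_β hw, funext fun k => ?_, naturalBag_A_mulVec_β hw, ?_⟩
  · simp [naturalBag_vecMul_L]
  · convert naturalBag_A_mul_L hw

end Cycle

/-! ### Paths and blocks -/

section Graph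

variable {V : Type*}

/-- A walk can be shortened to a path, encoded as a sequence of vertices that is injective on
`{0, …, m}`; its values beyond `m` are irrelevant. -/
theorem exists_injOn_path {r : V → V → Prop} {x y : V} (h : ReflTransGen r x y) :
    ∃ (m : ℕ) (f : ℕ → V), f 0 = x ∧ f m = y ∧ (∀ i < m, r (f i) (f (i + 1))) ∧
      Set.InjOn f (Set.Iic m) := by
  induction h using ReflTransGen.head_induction_on with
  | refl => exact ⟨0, fun _ => y, rfl, rfl, by simp, by intro a ha b hb _; simp_all⟩
  | @head x x' hx _ ih =>
    obtain ⟨m, f, hf0, hfm, hf, hinj⟩ := ih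
    by_cases hmem : ∃ j ≤ m, f j = x
    · obtain ⟨j, hj, hfj⟩ := hmem
      refine ⟨m - j, fun i => f (j + i), hfj, ?_, fun i hi => hf (j + i) (by omega), ?_⟩
      · show f (j + (m - j)) = y
        rw [Nat.add_sub_cancel' hj, hfm]
      · intro a ha b hb hab
        simp only [Set.mem_Iic] at ha hb
        have := hinj (Set.mem_Iic.2 (by omega : j + a ≤ m)) (Set.mem_Iic.2 (by omega)) hab
        omega
    · push Not at hmem
      refine ⟨m + 1, fun i => Nat.casesOn i x f, rfl, hfm, ?_, ?_⟩
      · rintro (_ | i) hi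
        · simpa [hf0] using hx
        · exact hf i (by omega)
      · rintro (_ | a) ha (_ | b) hb hab
        · rfl
        · exact absurd hab.symm (hmem b (by simpa using hb))
        · exact absurd hab (hmem a (by simpa using ha))
        · simp only [Set.mem_Iic] at ha hb
          exact congrArg _ (hinj (Set.mem_Iic.2 (by omega)) (Set.mem_Iic.2 (by omega)) hab)

variable {G : Digraph V}

theorem reflTransGen_of_path {r : V → V → Prop} {f : ℕ → V} {i j : ℕ} (hij : i ≤ j)
    (h : ∀ t, i ≤ t → t < j → r (f t) (f (t + 1))) : ReflTransGen r (f i) (f j) := by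
  induction j, hij using Nat.le_induction with
  | base => exact .refl
  | succ j hij ih => exact (ih fun t h1 h2 => h t h1 (by omega)).tail (h j hij (by omega))

namespace Subdigraph

instance : PartialOrder (Subdigraph G) where
  le_refl _ := ⟨subset_rfl, fun _ _ => id⟩
  le_trans _ _ _ h h' := ⟨h.1.trans h'.1, fun _ _ hab => h'.2 _ _ (h.2 _ _ hab)⟩
  le_antisymm _ _ h h' := Subdigraph.ext (h.1.antisymm h'.1)
    (funext₂ fun a b => propext ⟨h.2 a b, h'.2 a b⟩)

instance [Finite V] : Finite (Subdigraph G) :=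
  Finite.of_injective (fun H => (H.verts, H.Adj)) fun _ _ h =>
    Subdigraph.ext (congrArg Prod.fst h) (congrArg Prod.snd h)

/-- The subdigraph `H` together with the arcs of the walk `f 0, f 1, …, f m` in `G`. -/
def addPath (H : Subdigraph G) (f : ℕ → V) (m : ℕ) (hf : ∀ i < m, G.Adj (f i) (f (i + 1))) :
    Subdigraph G where
  verts := H.verts ∪ f '' Set.Iic m
  Adj a b := H.Adj a b ∨ ∃ i < m, a = f i ∧ b = f (i + 1)
  adj_sub := by
    rintro a b (h | ⟨i, hi, rfl, rfl⟩)
    exacts [H.adj_sub h, hf i hi]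
  fst_mem := by
    rintro a b (h | ⟨i, hi, rfl, rfl⟩)
    exacts [.inl (H.fst_mem h), .inr ⟨i, hi.le, rfl⟩]
  snd_mem := by
    rintro a b (h | ⟨i, hi, rfl, rfl⟩)
    exacts [.inl (H.snd_mem h), .inr ⟨i + 1, hi, rfl⟩]

variable {H : Subdigraph G} {f : ℕ → V} {m : ℕ} {hf : ∀ i < m, G.Adj (f i) (f (i + 1))}

theorem le_addPath : H ≤ H.addPath f m hf :=
  ⟨Set.subset_union_left, fun _ _ => .inl⟩

theorem addPath_stronglyConnected (h0 : f 0 ∈ H.verts) (hm : f m ∈ H.verts)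
    (hH : ∀ a ∈ H.verts, ∀ b ∈ H.verts, ReflTransGen (H.addPath f m hf).Adj a b) :
    (H.addPath f m hf).StronglyConnected := by
  refine ⟨⟨f 0, .inl h0⟩, ?_⟩
  have hpath : ∀ i j, i ≤ j → j ≤ m → ReflTransGen (H.addPath f m hf).Adj (f i) (f j) :=
    fun i j hij hj => reflTransGen_of_path hij fun t _ ht => .inr ⟨t, by omega, rfl, rfl⟩
  have hfrom : ∀ a ∈ (H.addPath f m hf).verts, ∃ s ∈ H.verts,
      ReflTransGen (H.addPath f m hf).Adj a s := by
    rintro a (ha | ⟨i, hi, rfl⟩)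
    exacts [⟨a, ha, .refl⟩, ⟨f m, hm, hpath i m hi le_rfl⟩]
  have hto : ∀ b ∈ (H.addPath f m hf).verts, ∃ s ∈ H.verts,
      ReflTransGen (H.addPath f m hf).Adj s b := by
    rintro b (hb | ⟨i, hi, rfl⟩)
    exacts [⟨b, hb, .refl⟩, ⟨f 0, h0, hpath 0 i (Nat.zero_le _) hi⟩]
  intro a ha b hb
  obtain ⟨s, hs, has⟩ := hfrom a ha
  obtain ⟨t, ht, htb⟩ := hto b hb
  exact has.trans ((hH s hs t ht).trans htb)

/-- Adding a path with both ends in `H` creates no cut vertex: when a vertex is deleted,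
each remaining vertex of the path is still joined to one of the ends. -/
theorem not_isCutVertex_addPath (h0 : f 0 ∈ H.verts) (hm : f m ∈ H.verts)
    (hinj : Set.InjOn f (Set.Iic m)) (hconn : ¬ H.Disconnected)
    (hcut : ∀ z, ¬ H.IsCutVertex z) (z : V) : ¬ (H.addPath f m hf).IsCutVertex z := by
  rintro ⟨-, a, ⟨ha, haz⟩, b, ⟨hb, hbz⟩, hab⟩
  set K := (H.addPath f m hf).deleteVert z
  have : Std.Symm fun x y => K.Adj x y ∨ K.Adj y x := ⟨fun _ _ => Or.symm⟩
  have hsymm : ∀ {x y}, ReflTransGen (fun x y => K.Adj x y ∨ K.Adj y x) x y →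
      ReflTransGen (fun x y => K.Adj x y ∨ K.Adj y x) y x := fun h => Std.Symm.symm _ _ h
  have hH : ∀ s ∈ H.verts, s ≠ z → ∀ t ∈ H.verts, t ≠ z →
      ReflTransGen (fun x y => K.Adj x y ∨ K.Adj y x) s t := by
    intro s hs hsz t ht htz
    by_cases hz : z ∈ H.verts
    · have h : ReflTransGen (fun x y => (H.deleteVert z).Adj x y ∨ (H.deleteVert z).Adj y x)
          s t := by
        by_contra hc
        exact hcut z ⟨hz, s, ⟨hs, hsz⟩, t, ⟨ht, htz⟩, hc⟩
      refine ReflTransGen.mono (fun x y => ?_) _ _ h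
      exact Or.imp (fun h => ⟨.inl h.1, h.2⟩) fun h => ⟨.inl h.1, h.2⟩
    · have h : ReflTransGen (fun x y => H.Adj x y ∨ H.Adj y x) s t := by
        by_contra hc
        exact hconn ⟨s, hs, t, ht, hc⟩
      have key : ∀ x y, H.Adj x y → K.Adj x y := fun x y hxy =>
        ⟨.inl hxy, fun hc => hz (hc ▸ H.fst_mem hxy), fun hc => hz (hc ▸ H.snd_mem hxy)⟩
      refine ReflTransGen.mono (fun x y => ?_) _ _ h
      exact Or.imp (key x y) (key y x)
  have hpath : ∀ i j, i ≤ j → j ≤ m → (∀ t, i ≤ t → t ≤ j → f t ≠ z) →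
      ReflTransGen (fun x y => K.Adj x y ∨ K.Adj y x) (f i) (f j) := fun i j hij hj hz =>
    reflTransGen_of_path hij fun t h1 h2 =>
      .inl ⟨.inr ⟨t, by omega, rfl, rfl⟩, hz t h1 h2.le, hz _ (by omega) h2⟩
  have hjoin : ∀ p ∈ (H.addPath f m hf).verts, p ≠ z → ∃ s ∈ H.verts, s ≠ z ∧
      ReflTransGen (fun x y => K.Adj x y ∨ K.Adj y x) p s := by
    rintro p (hp | ⟨i, hi, rfl⟩) hpz
    · exact ⟨p, hp, hpz, .refl⟩
    by_cases hz : ∃ j ≤ i, f j = z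
    · obtain ⟨j, hj, rfl⟩ := hz
      have hlt : j < i := lt_of_le_of_ne hj fun hc => hpz (hc ▸ rfl)
      have hav : ∀ t, i ≤ t → t ≤ m → f t ≠ f j := fun t h1 h2 hc => by
        have := hinj (Set.mem_Iic.2 h2) (Set.mem_Iic.2 (hj.trans hi)) hc
        omega
      exact ⟨f m, hm, hav m hi le_rfl, hpath i m hi le_rfl hav⟩
    · push Not at hz
      exact ⟨f 0, h0, hz 0 (Nat.zero_le _),
        hsymm (hpath 0 i (Nat.zero_le _) hi fun t _ ht => hz t ht)⟩
  obtain ⟨s, hs, hsz, has⟩ := hjoin a ha haz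
  obtain ⟨t, ht, htz, hbt⟩ := hjoin b hb hbz
  exact hab (has.trans ((hH s hs hsz t ht htz).trans (hsymm hbt)))

theorem StronglyConnected.not_disconnected (h : H.StronglyConnected) : ¬ H.Disconnected := by
  rintro ⟨a, ha, b, hb, hab⟩
  exact hab (ReflTransGen.mono (fun _ _ => .inl) _ _ (h.2 a ha b hb))

/-- A directed path with both ends in a block runs inside that block. -/
theorem IsBlock.adj_of_path (hH : H.IsBlock) (hf : ∀ i < m, G.Adj (f i) (f (i + 1)))
    (h0 : f 0 ∈ H.verts) (hm : f m ∈ H.verts)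
    (hinj : Set.InjOn f (Set.Iic m)) : ∀ i < m, H.Adj (f i) (f (i + 1)) := by
  obtain ⟨hconn, hnt, hcut⟩ := hH.prop
  have hK : H.addPath f m hf ≤ H := hH.le_of_ge
    ⟨addPath_stronglyConnected h0 hm fun a ha b hb =>
        ReflTransGen.mono le_addPath.2 _ _ (hconn.2 a ha b hb), hnt.mono le_addPath.1,
      not_isCutVertex_addPath h0 hm hinj hconn.not_disconnected hcut⟩ le_addPath
  exact fun i hi => hK.2 _ _ (.inr ⟨i, hi, rfl, rfl⟩)

theorem IsBlock.adj_of_adj (hH : H.IsBlock) {a b : V} (ha : a ∈ H.verts) (hb : b ∈ H.verts)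
    (hne : a ≠ b) (h : G.Adj a b) : H.Adj a b := by
  have := hH.adj_of_path (f := fun i => if i = 0 then a else b) (m := 1)
    (by simpa using h) (by simpa using ha) (by simpa using hb)
    (by
      intro i hi j hj hij
      simp only [Set.mem_Iic] at hi hj
      interval_cases i <;> interval_cases j <;> simp_all [eq_comm]) 0 one_pos
  simpa using this

end Subdigraph

open Subdigraph

/-- In a strongly connected digraph each arc `(a, b)` lies in a block, since it lies on a
directed cycle. -/
theorem StronglyConnected.exists_isBlock_adj [Finite V] (hG : StronglyConnected G) {a b : V}
    (hab : G.Adj a b) (hne : a ≠ b) : ∃ H : Subdigraph G, H.IsBlock ∧ H.Adj a b := by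
  -- A path from `b` to `a`, added to the arc `(a, b)`, makes up a directed cycle, and a maximal
  -- strongly connected subdigraph without cut vertices above this cycle is a block.
  let A : Subdigraph G :=
    { verts := {a, b}
      Adj := fun x y => x = a ∧ y = b
      adj_sub := by rintro x y ⟨rfl, rfl⟩; exact hab
      fst_mem := by rintro x y ⟨rfl, rfl⟩; simp
      snd_mem := by rintro x y ⟨rfl, rfl⟩; simp }
  obtain ⟨m, f, hf0, hfm, hf, hinj⟩ := exists_injOn_path (hG.2 b a)
  have h0 : f 0 ∈ A.verts := by simp [A, hf0]
  have hm : f m ∈ A.verts := by simp [A, hfm]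
  have hpath : ReflTransGen (A.addPath f m hf).Adj b a := by
    rw [← hf0, ← hfm]
    exact reflTransGen_of_path (Nat.zero_le _) fun t _ ht => .inr ⟨t, ht, rfl, rfl⟩
  have hconn : ¬ A.Disconnected := by
    rintro ⟨x, hx, y, hy, h⟩
    refine h ?_
    rcases hx with rfl | rfl <;> rcases hy with rfl | rfl
    exacts [.refl, .single (.inl ⟨rfl, rfl⟩), .single (.inr ⟨rfl, rfl⟩), .refl]
  have hcut : ∀ z, ¬ A.IsCutVertex z := by
    rintro z ⟨hz, x, ⟨hx, hxz⟩, y, ⟨hy, hyz⟩, h⟩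
    refine h ?_
    have : x = y := by
      simp only [Set.mem_singleton_iff] at hxz hyz
      rcases hx with rfl | rfl <;> rcases hy with rfl | rfl <;> rcases hz with rfl | rfl <;>
        first | rfl | exact absurd rfl hxz | exact absurd rfl hyz
    exact this ▸ .refl
  have hK : (A.addPath f m hf).StronglyConnected ∧ (A.addPath f m hf).verts.Nontrivial ∧
      ∀ z, ¬ (A.addPath f m hf).IsCutVertex z := by
    refine ⟨addPath_stronglyConnected h0 hm ?_,
      ⟨a, .inl (by simp [A]), b, .inl (by simp [A]), hne⟩,
      not_isCutVertex_addPath h0 hm hinj hconn hcut⟩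
    rintro x (rfl | rfl) y (rfl | rfl)
    exacts [.refl, .single (.inl ⟨rfl, rfl⟩), hpath, .refl]
  obtain ⟨H, hle, hH⟩ := (Set.toFinite {K : Subdigraph G | K.StronglyConnected ∧
    K.verts.Nontrivial ∧ ∀ x, ¬ K.IsCutVertex x}).exists_le_maximal hK
  exact ⟨H, hH, hle.2 _ _ (.inl ⟨rfl, rfl⟩)⟩

/-- The blocks of a cactoid digraph are arc-disjoint: a block that shares the arc `(a, b)` with the
directed cycle `K` contains the rest of `K`, a path from `b` to `a`. -/
theorem Subdigraph.IsBlock.eq_of_adj {H K : Subdigraph G} (hH : H.IsBlock) (hK : K.IsBlock)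
    {n : ℕ} {e : ZMod n ≃ K.verts} (he : K.IsCycleLabelling n e) {a b : V} (hHab : H.Adj a b)
    (hKab : K.Adj a b) : H = K := by
  have : Fact (1 < n) := ⟨he.1⟩
  have hpred : ((n - 1 : ℕ) : ZMod n) = -1 := by simp [Nat.cast_sub this.out.le]
  obtain ⟨κ, hκ⟩ := e.surjective ⟨a, K.fst_mem hKab⟩
  have ha : (e κ : V) = a := congrArg Subtype.val hκ
  have hb : (e (κ + 1) : V) = b := by
    obtain ⟨l, hl⟩ := e.surjective ⟨b, K.snd_mem hKab⟩
    have hl' : (e l : V) = b := congrArg Subtype.val hl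
    rw [← (he.2 κ l).1 (by rwa [ha, hl']), hl']
  -- The path in `K` from `b` all the way round to `a`; only the arc `(a, b)` is missing.
  set f : ℕ → V := fun t => e (κ + 1 + t) with hf
  have hlast : f (n - 1) = a := by
    simp [← ha, hf, hpred]
  have hadj : ∀ i, K.Adj (f i) (f (i + 1)) := fun i => (he.2 _ _).2 (by push_cast; ring)
  have hfirst : f 0 = b := by simp [hf, hb]
  have hpath := hH.adj_of_path (f := f) (m := n - 1) (fun i _ => K.adj_sub (hadj i))
    (hfirst ▸ H.snd_mem hHab) (hlast ▸ H.fst_mem hHab)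
    (by
      intro i hi j hj hij
      have hij' : (i : ZMod n) = j := add_left_cancel (e.injective (Subtype.val_injective hij))
      have hn := he.1
      simp only [Set.mem_Iic] at hi hj
      rw [← ZMod.val_cast_of_lt (by omega : i < n), hij', ZMod.val_cast_of_lt (by omega)])
  have hsucc : ∀ k, H.Adj (e k) (e (k + 1)) := by
    intro k
    obtain ⟨t, ht, rfl⟩ : ∃ t < n, κ + 1 + (t : ZMod n) = k :=
      ⟨(k - (κ + 1)).val, ZMod.val_lt _, by simp⟩
    rcases lt_or_eq_of_le (Nat.le_sub_one_of_lt ht) with h | rfl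
    · simpa [hf, add_assoc] using hpath t h
    · have h1 : κ + 1 + ((n - 1 : ℕ) : ZMod n) = κ := by simp [hpred]
      rwa [h1, ha, hb]
  have hle : K ≤ H := by
    refine ⟨fun v hv => ?_, fun x y hxy => ?_⟩
    · obtain ⟨k, hk⟩ := e.surjective ⟨v, hv⟩
      have : (e k : V) = v := congrArg Subtype.val hk
      exact this ▸ H.fst_mem (hsucc k)
    · obtain ⟨k, hk⟩ := e.surjective ⟨x, K.fst_mem hxy⟩
      obtain ⟨l, hl⟩ := e.surjective ⟨y, K.snd_mem hxy⟩
      have hx : (e k : V) = x := congrArg Subtype.val hk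
      have hy : (e l : V) = y := congrArg Subtype.val hl
      rw [← hx, ← hy] at hxy ⊢
      rw [(he.2 k l).1 hxy]
      exact hsucc k
  exact le_antisymm (hK.le_of_ge hH.prop hle) hle

end Graph

/-! ### Gates of blocks -/

section Gate

variable {V : Type*} {G : Digraph V} {S : Set V}

/-- `x` is the last vertex in `S` of some walk to `v`. -/
def ExitsAt (G : Digraph V) (S : Set V) (x v : V) : Prop :=
  x ∈ S ∧ ReflTransGen (fun a b => G.Adj a b ∧ b ∉ S) x v

/-- `x` is the first vertex in `S` of some walk from `v`. -/
def EntersAt (G : Digraph V) (S : Set V) (v x : V) : Prop :=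
  x ∈ S ∧ ReflTransGen (fun a b => G.Adj a b ∧ a ∉ S) v x

/-- The gate of `v` in `S`: a last vertex in `S` on the way to `v` (and `v` itself if there is
none). For a block `S` it is the only one, and also the only first vertex in `S` on the way
from `v`. -/
noncomputable def gate (G : Digraph V) (S : Set V) (v : V) : V :=
  if h : ∃ x, ExitsAt G S x v then h.choose else v

theorem StronglyConnected.exists_exitsAt (hG : StronglyConnected G) (hS : S.Nonempty) (v : V) :
    ∃ x, ExitsAt G S x v := by
  obtain ⟨s, hs⟩ := hS
  induction hG.2 s v with
  | refl => exact ⟨s, hs, .refl⟩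
  | @tail b c _ hbc ih =>
    obtain ⟨x, hx, h⟩ := ih
    by_cases hc : c ∈ S
    exacts [⟨c, hc, .refl⟩, ⟨x, hx, h.tail ⟨hbc, hc⟩⟩]

theorem StronglyConnected.exists_entersAt (hG : StronglyConnected G) (hS : S.Nonempty) (v : V) :
    ∃ x, EntersAt G S v x := by
  obtain ⟨s, hs⟩ := hS
  induction hG.2 v s using ReflTransGen.head_induction_on with
  | refl => exact ⟨s, hs, .refl⟩
  | @head a b hab _ ih =>
    obtain ⟨x, hx, h⟩ := ih
    by_cases ha : a ∈ S
    exacts [⟨a, ha, .refl⟩, ⟨x, hx, h.head ⟨hab, ha⟩⟩]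

/-- If a walk leaves a block at `x` for good, and goes on to return to the block first at `y`, then
`x = y`, as otherwise it would contain a path with distinct ends in the block that runs outside. -/
theorem ExitsAt.eq_of_entersAt {H : Subdigraph G} (hH : H.IsBlock) {x y v : V}
    (hx : ExitsAt G H.verts x v) (hy : EntersAt G H.verts v y) : x = y := by
  by_contra hne
  have h : ReflTransGen (fun a b => G.Adj a b ∧ ¬ (a ∈ H.verts ∧ b ∈ H.verts)) x y :=
    .trans (ReflTransGen.mono (fun _ _ h => ⟨h.1, fun hc => h.2 hc.2⟩) _ _ hx.2)
      (ReflTransGen.mono (fun _ _ h => ⟨h.1, fun hc => h.2 hc.1⟩) _ _ hy.2)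
  obtain ⟨m, f, rfl, rfl, hf, hinj⟩ := exists_injOn_path h
  have hm : 0 < m := Nat.pos_of_ne_zero fun hc => hne (by rw [hc])
  have := hH.adj_of_path (fun i hi => (hf i hi).1) hx.1 hy.1 hinj 0 hm
  exact (hf 0 hm).2 ⟨H.fst_mem this, H.snd_mem this⟩

variable {H : Subdigraph G}

theorem exitsAt_gate (hG : StronglyConnected G) (hH : H.IsBlock) (v : V) :
    ExitsAt G H.verts (gate G H.verts v) v := by
  have h := hG.exists_exitsAt hH.prop.1.1 v
  rw [gate, dif_pos h]
  exact h.choose_spec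

theorem EntersAt.eq_gate (hG : StronglyConnected G) (hH : H.IsBlock) {v x : V}
    (h : EntersAt G H.verts v x) : x = gate G H.verts v :=
  ((exitsAt_gate hG hH v).eq_of_entersAt hH h).symm

theorem ExitsAt.eq_gate (hG : StronglyConnected G) (hH : H.IsBlock) {v x : V}
    (h : ExitsAt G H.verts x v) : x = gate G H.verts v := by
  obtain ⟨y, hy⟩ := hG.exists_entersAt hH.prop.1.1 v
  rw [h.eq_of_entersAt hH hy, hy.eq_gate hG hH]

theorem gate_of_mem (hG : StronglyConnected G) (hH : H.IsBlock) {v : V} (hv : v ∈ H.verts) :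
    gate G H.verts v = v :=
  (ExitsAt.eq_gate hG hH ⟨hv, .refl⟩).symm

theorem gate_eq_of_adj (hG : StronglyConnected G) (hH : H.IsBlock) {a b : V} (hab : G.Adj a b)
    (hb : b ∉ H.verts) : gate G H.verts b = gate G H.verts a :=
  have h := exitsAt_gate hG hH a
  (ExitsAt.eq_gate hG hH ⟨h.1, h.2.tail ⟨hab, hb⟩⟩).symm

theorem gate_eq_of_adj_mem (hG : StronglyConnected G) (hH : H.IsBlock) {a b : V}
    (hab : G.Adj a b) (ha : a ∉ H.verts) (hb : b ∈ H.verts) : gate G H.verts a = b :=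
  (EntersAt.eq_gate hG hH ⟨hb, .single ⟨hab, ha⟩⟩).symm

/-- If a walk starts with an arc `(u, c)` of a block and does not return to `u`, then the gate of
its end in that block is not `u`. -/
theorem gate_ne_of_adj (hG : StronglyConnected G) (hH : H.IsBlock) {u c v : V} (huc : H.Adj u c)
    (hne : c ≠ u) (hcv : ReflTransGen (fun a b => G.Adj a b ∧ b ≠ u) c v) :
    gate G H.verts v ≠ u := by
  induction hcv with
  | refl => rwa [gate_of_mem hG hH (H.snd_mem huc)]
  | @tail y z _ hyz ih =>
    by_cases hz : z ∈ H.verts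
    · rw [gate_of_mem hG hH hz]
      exact hyz.2
    · rwa [gate_eq_of_adj hG hH hyz.1 hz]

/-- If a walk leaves a block at `u` with an arc `(u, c)` outside the block and does not return
to `u`, then it does not return to the block. -/
theorem gate_eq_of_not_adj (hG : StronglyConnected G) (hH : H.IsBlock) {u c v : V}
    (hu : u ∈ H.verts) (huc : G.Adj u c) (hnot : ¬ H.Adj u c) (hne : c ≠ u)
    (hcv : ReflTransGen (fun a b => G.Adj a b ∧ b ≠ u) c v) : gate G H.verts v = u := by
  suffices h : v ∉ H.verts ∧ gate G H.verts v = u from h.2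
  induction hcv with
  | refl =>
    have hc : c ∉ H.verts := fun hc => hnot (hH.adj_of_adj hu hc hne.symm huc)
    exact ⟨hc, by rw [gate_eq_of_adj hG hH huc hc, gate_of_mem hG hH hu]⟩
  | @tail y z _ hyz ih =>
    have hz : z ∉ H.verts := fun hz =>
      hyz.2 ((gate_eq_of_adj_mem hG hH hyz.1 ih.1 hz).symm.trans ih.2)
    exact ⟨hz, by rw [gate_eq_of_adj hG hH hyz.1 hz, ih.2]⟩

theorem Subdigraph.IsCycleLabelling.eq_of_adj {n : ℕ} {e : ZMod n ≃ H.verts}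
    (he : H.IsCycleLabelling n e) {k : ZMod n} {b : V} (h : H.Adj (e k) b) : b = e (k + 1) := by
  obtain ⟨l, hl⟩ := e.surjective ⟨b, H.snd_mem h⟩
  have hb : (e l : V) = b := congrArg Subtype.val hl
  rw [← hb] at h ⊢
  rw [(he.2 k l).1 h]

/-- In a cactoid digraph a path from `u` to `v` has only one choice for its first arc: the arc
at `u` of the unique block in which `u` is not the gate of `v`. -/
theorem IsCactoid.eq_of_adj [Finite V] (hG : IsCactoid G) {u c c' v : V} (hc : G.Adj u c)
    (hne : c ≠ u) (hcv : ReflTransGen (fun a b => G.Adj a b ∧ b ≠ u) c v) (hc' : G.Adj u c')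
    (hne' : c' ≠ u) (hcv' : ReflTransGen (fun a b => G.Adj a b ∧ b ≠ u) c' v) : c = c' := by
  obtain ⟨K, hK, hKc⟩ := hG.1.exists_isBlock_adj hc hne.symm
  obtain ⟨K', hK', hKc'⟩ := hG.1.exists_isBlock_adj hc' hne'.symm
  obtain ⟨n, e, he⟩ := hG.2 K hK
  have hK'c : K'.Adj u c := by
    by_contra hnot
    exact gate_ne_of_adj hG.1 hK' hKc' hne' hcv'
      (gate_eq_of_not_adj hG.1 hK' (K'.fst_mem hKc') hc hnot hne hcv)
  obtain rfl := hK'.eq_of_adj hK he hK'c hKc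
  obtain ⟨k, hk⟩ := e.surjective ⟨u, K'.fst_mem hKc⟩
  have hu : (e k : V) = u := congrArg Subtype.val hk
  rw [← hu] at hKc hKc'
  rw [he.eq_of_adj hKc, he.eq_of_adj hKc']

end Gate

/-! ### Shortest walks -/

namespace Walk

variable {V : Type*} {G : Digraph V} {R : Type*} [CommRing R]

/-- Concatenation of walks. -/
def append : {a b c : V} → Walk G a b → Walk G b c → Walk G a c
  | _, _, _, nil _, q => q
  | _, _, _, cons h p, q => cons h (p.append q)

@[simp]
theorem length_append {a b c : V} (p : Walk G a b) (q : Walk G b c) :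
    (p.append q).length = p.length + q.length := by
  induction p with
  | nil => simp [append, length]
  | cons h p ih => simp only [append, length, ih]; omega

@[simp]
theorem weight_append (w : V → V → R) {a b c : V} (p : Walk G a b) (q : Walk G b c) :
    (p.append q).weight w = p.weight w + q.weight w := by
  induction p with
  | nil => simp [append, weight]
  | cons h p ih => simp only [append, weight, ih, add_assoc]

theorem IsShortest.of_append_left {a b c : V} {p : Walk G a b} {q : Walk G b c}
    (h : (p.append q).IsShortest) : p.IsShortest := fun p' => by
  have := h (p'.append q)
  simpa using this

theorem IsShortest.of_append_right {a b c : V} {p : Walk G a b} {q : Walk G b c}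
    (h : (p.append q).IsShortest) : q.IsShortest := fun q' => by
  have := h (p.append q')
  simpa using this

theorem IsShortest.of_cons {a b c : V} {h : G.Adj a b} {p : Walk G b c}
    (hp : (cons h p).IsShortest) : p.IsShortest := fun q => by
  have := hp (cons h q)
  simpa [length] using this

theorem exists_of_reflTransGen {a b : V} (h : ReflTransGen G.Adj a b) : Nonempty (Walk G a b) := by
  induction h using ReflTransGen.head_induction_on with
  | refl => exact ⟨nil b⟩
  | head h _ ih => exact ih.map (cons h)

theorem exists_isShortest (hG : StronglyConnected G) (a b : V) :
    ∃ p : Walk G a b, p.IsShortest := by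
  have := exists_of_reflTransGen (hG.2 a b)
  exact ⟨Function.argmin length, fun q => Function.argmin_le length q⟩

/-- A walk either avoids the vertex `u` or has a final part that starts at `u`. -/
theorem reflTransGen_or_exists_le (u : V) {c v : V} (p : Walk G c v) :
    (c ≠ u ∧ ReflTransGen (fun a b => G.Adj a b ∧ b ≠ u) c v) ∨
      ∃ q : Walk G u v, q.length ≤ p.length := by
  induction p with
  | nil c =>
    by_cases hc : c = u
    · subst hc
      exact .inr ⟨nil c, le_rfl⟩
    · exact .inl ⟨hc, .refl⟩
  | @cons a b v h p ih =>
    rcases ih with ⟨hb, hp⟩ | ⟨q, hq⟩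
    · by_cases ha : a = u
      · subst ha
        exact .inr ⟨cons h p, le_rfl⟩
      · exact .inl ⟨ha, hp.head ⟨h, hb⟩⟩
    · exact .inr ⟨q, hq.trans (Nat.le_succ _)⟩

/-- A shortest walk does not return to its first vertex. -/
theorem IsShortest.avoids {u c v : V} {h : G.Adj u c} {p : Walk G c v}
    (hp : (cons h p).IsShortest) :
    c ≠ u ∧ ReflTransGen (fun a b => G.Adj a b ∧ b ≠ u) c v := by
  refine (p.reflTransGen_or_exists_le u).resolve_right ?_
  rintro ⟨q, hq⟩
  exact absurd ((hp q).trans hq) (Nat.not_succ_le_self _)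

theorem weight_eq_of_isShortest [Finite V] (hG : IsCactoid G) (w : V → V → R) {a b : V}
    {p q : Walk G a b} (hp : p.IsShortest) (hq : q.IsShortest) : p.weight w = q.weight w := by
  induction p with
  | nil a =>
    cases q with
    | nil => rfl
    | cons h q => exact absurd (hq (nil a)) (Nat.not_succ_le_zero _)
  | @cons a c b h p ih =>
    cases q with
    | nil => exact absurd (hp (nil a)) (Nat.not_succ_le_zero _)
    | @cons _ c' _ h' q =>
      obtain rfl := hG.eq_of_adj h hp.avoids.1 hp.avoids.2 h' hq.avoids.1 hq.avoids.2
      simp only [weight, ih hp.of_cons hq.of_cons]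

theorem weight_eq_distMatrix [Finite V] (hG : IsCactoid G) (w : V → V → R) {a b : V}
    {p : Walk G a b} (hp : p.IsShortest) : p.weight w = distMatrix G w a b := by
  have h : ∃ p : Walk G a b, p.IsShortest := ⟨p, hp⟩
  rw [distMatrix, dif_pos h]
  exact weight_eq_of_isShortest hG w hp h.choose_spec

/-- A walk either avoids `S` or splits at its last vertex in `S`. -/
theorem exists_append_of_exitsAt (S : Set V) {a v : V} (p : Walk G a v) :
    (a ∉ S ∧ ReflTransGen (fun a b => G.Adj a b ∧ b ∉ S) a v) ∨
      ∃ x, ExitsAt G S x v ∧ ∃ (p₁ : Walk G a x) (p₂ : Walk G x v), p = p₁.append p₂ := by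
  induction p with
  | nil a =>
    by_cases ha : a ∈ S
    exacts [.inr ⟨a, ⟨ha, .refl⟩, nil a, nil a, rfl⟩, .inl ⟨ha, .refl⟩]
  | @cons a b v h p ih =>
    rcases ih with ⟨hb, hp⟩ | ⟨x, hx, p₁, p₂, rfl⟩
    · have hav := hp.head ⟨h, hb⟩
      by_cases ha : a ∈ S
      exacts [.inr ⟨a, ⟨ha, hav⟩, nil a, cons h p, rfl⟩, .inl ⟨ha, hav⟩]
    · exact .inr ⟨x, hx, cons h p₁, p₂, rfl⟩

/-- A walk that ends in `S` splits at its first vertex in `S`. -/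
theorem exists_append_of_entersAt {S : Set V} {v s : V} (p : Walk G v s) (hs : s ∈ S) :
    ∃ x, EntersAt G S v x ∧ ∃ (p₁ : Walk G v x) (p₂ : Walk G x s), p = p₁.append p₂ := by
  induction p with
  | nil a => exact ⟨a, ⟨hs, .refl⟩, nil a, nil a, rfl⟩
  | @cons a b v h p ih =>
    by_cases ha : a ∈ S
    · exact ⟨a, ⟨ha, .refl⟩, nil a, cons h p, rfl⟩
    · obtain ⟨x, hx, p₁, p₂, rfl⟩ := ih hs
      exact ⟨x, ⟨hx.1, hx.2.head ⟨h, ha⟩⟩, cons h p₁, p₂, rfl⟩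

end Walk

/-! ### The distance matrix -/

section Distance

variable {V : Type*} [Finite V] {G : Digraph V} {R : Type*} [CommRing R] {H : Subdigraph G}

theorem distMatrix_self (hG : IsCactoid G) (w : V → V → R) (v : V) : distMatrix G w v v = 0 :=
  (Walk.weight_eq_distMatrix hG w (p := Walk.nil v) fun _ => Nat.zero_le _).symm

theorem distMatrix_eq_add_of_isShortest_append (hG : IsCactoid G) (w : V → V → R) {a b c : V}
    {p : Walk G a b} {q : Walk G b c} (h : (p.append q).IsShortest) :
    distMatrix G w a c = distMatrix G w a b + distMatrix G w b c := by
  rw [← Walk.weight_eq_distMatrix hG w h, Walk.weight_append,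
    Walk.weight_eq_distMatrix hG w h.of_append_left,
    Walk.weight_eq_distMatrix hG w h.of_append_right]

theorem distMatrix_split_left (hG : IsCactoid G) (w : V → V → R) (hH : H.IsBlock) {x : V}
    (hx : x ∈ H.verts) (v : V) : distMatrix G w x v =
      distMatrix G w x (gate G H.verts v) + distMatrix G w (gate G H.verts v) v := by
  obtain ⟨p, hp⟩ := Walk.exists_isShortest hG.1 x v
  obtain ⟨y, hy, p₁, p₂, rfl⟩ :=
    (p.exists_append_of_exitsAt H.verts).resolve_left fun h => h.1 hx
  rw [← hy.eq_gate hG.1 hH]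
  exact distMatrix_eq_add_of_isShortest_append hG w hp

theorem distMatrix_split_right (hG : IsCactoid G) (w : V → V → R) (hH : H.IsBlock) {x : V}
    (hx : x ∈ H.verts) (v : V) : distMatrix G w v x =
      distMatrix G w v (gate G H.verts v) + distMatrix G w (gate G H.verts v) x := by
  obtain ⟨p, hp⟩ := Walk.exists_isShortest hG.1 v x
  obtain ⟨y, hy, p₁, p₂, rfl⟩ := p.exists_append_of_entersAt hx
  rw [← hy.eq_gate hG.1 hH]
  exact distMatrix_eq_add_of_isShortest_append hG w hp

theorem exists_adj_avoids_distMatrix_eq (hG : IsCactoid G) (w : V → V → R) {u v : V}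
    (huv : u ≠ v) : ∃ c, G.Adj u c ∧ c ≠ u ∧
      ReflTransGen (fun a b => G.Adj a b ∧ b ≠ u) c v ∧
      distMatrix G w u v = w u c + distMatrix G w c v := by
  obtain ⟨p, hp⟩ := Walk.exists_isShortest hG.1 u v
  cases p with
  | nil => exact absurd rfl huv
  | @cons _ c _ h p =>
    refine ⟨c, h, hp.avoids.1, hp.avoids.2, ?_⟩
    rw [← Walk.weight_eq_distMatrix hG w hp, ← Walk.weight_eq_distMatrix hG w hp.of_cons]
    rfl

/-- Within a block, shortest paths run along the cycle. -/
theorem distMatrix_eq_cycleDist (hG : IsCactoid G) (w : V → V → R) (hH : H.IsBlock) {n : ℕ}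
    [NeZero n] {e : ZMod n ≃ H.verts} (he : H.IsCycleLabelling n e) (k l : ZMod n) :
    distMatrix G w (e k) (e l) = cycleDist n (cycleWeight w e) k l := by
  induction hd : (l - k).val generalizing k with
  | zero =>
    obtain rfl : l = k := sub_eq_zero.1 ((ZMod.val_eq_zero _).1 hd)
    rw [distMatrix_self hG, cycleDist_self]
  | succ d ih =>
    have hne : k ≠ l := by
      rintro rfl
      simp at hd
    have hne' : (e k : V) ≠ e l := fun h => hne (e.injective (Subtype.val_injective h))
    obtain ⟨c, hc, hcne, hcv, heq⟩ := exists_adj_avoids_distMatrix_eq hG w hne'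
    have hadj : H.Adj (e k) c := by
      by_contra hnot
      have := gate_eq_of_not_adj hG.1 hH (e k).2 hc hnot hcne hcv
      rw [gate_of_mem hG.1 hH (e l).2] at this
      exact hne' this.symm
    obtain rfl := he.eq_of_adj hadj
    rw [heq, ih (k + 1) (by have := val_sub_eq_succ hne; omega), cycleDist_of_ne _ hne,
      cycleWeight]

theorem isGatedMatrix_distMatrix (hG : IsCactoid G) (w : V → V → R) {r : ℕ}
    {H : Fin r → Subdigraph G} (hH : Function.Injective H)
    (hblock : ∀ K : Subdigraph G, K.IsBlock ↔ ∃ i, H i = K) :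
    IsGatedMatrix (distMatrix G w) (fun i => (H i).verts) (fun i => gate G (H i).verts) where
  gate_mem i v := (exitsAt_gate hG.1 ((hblock _).2 ⟨i, rfl⟩) v).1
  gate_self i v hv := gate_of_mem hG.1 ((hblock _).2 ⟨i, rfl⟩) hv
  unique_exit u v huv := by
    obtain ⟨c, hc, hne, hcv, -⟩ := exists_adj_avoids_distMatrix_eq hG w huv
    obtain ⟨K, hK, hKc⟩ := hG.1.exists_isBlock_adj hc hne.symm
    obtain ⟨i, rfl⟩ := (hblock K).1 hK
    refine ⟨i, ⟨(H i).fst_mem hKc, gate_ne_of_adj hG.1 hK hKc hne hcv⟩, ?_⟩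
    rintro j ⟨hj, hgj⟩
    have hjb : (H j).IsBlock := (hblock _).2 ⟨j, rfl⟩
    obtain ⟨n, e, he⟩ := hG.2 _ hK
    refine hH (hjb.eq_of_adj hK he ?_ hKc)
    by_contra hnot
    exact hgj (gate_eq_of_not_adj hG.1 hjb hj hc hnot hne hcv)
  apply_self := distMatrix_self hG w
  split_left i v _ hx := distMatrix_split_left hG w ((hblock _).2 ⟨i, rfl⟩) hx v
  split_right i v _ hx := distMatrix_split_right hG w ((hblock _).2 ⟨i, rfl⟩) hx v

end Distance

end CactoidDistance

open CactoidDistance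

theorem theorem4p3 {R : Type*} [CommRing R] {V : Type*} [Fintype V] [DecidableEq V]
    (G : Digraph V) (hG : CactoidDistance.IsCactoid G) (w : V → V → R)
    -- the blocks `H 0, …, H (r - 1)`, listed without repetition
    (r : ℕ) (H : Fin r → CactoidDistance.Subdigraph G) (hH : Function.Injective H)
    (hblock : ∀ K : CactoidDistance.Subdigraph G, K.IsBlock ↔ ∃ i, H i = K)
    -- the blocks as labelled directed cycles
    (n : Fin r → ℕ) (e : ∀ i, ZMod (n i) ≃ (H i).verts)
    (he : ∀ i, (H i).IsCycleLabelling (n i) (e i))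
    (hw : ∀ i, IsUnit (CactoidDistance.firstWeight (n i) (CactoidDistance.cycleWeight w (e i))))
    (Wc : Matrix V V R) (hWc : Wc = CactoidDistance.distMatrix G w)
    (B : CactoidDistance.Bag R V)
    (hB : B = CactoidDistance.compositionBag Wc (fun i => (H i).verts)
      (fun i => CactoidDistance.naturalBlockBag w (e i))) :
    -- the distance matrix does not depend on the choice of the shortest paths
    (∀ (a b : V) (p : CactoidDistance.Walk G a b), p.IsShortest → p.weight w = Wc a b) ∧
    -- the composition makes sense: the bags of the blocks hold the submatrices of `Wc`
    (∀ i, (CactoidDistance.naturalBlockBag w (e i)).A =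
      Wc.submatrix (Subtype.val : (H i).verts → V) (Subtype.val : (H i).verts → V)) ∧
    B.IsLeftLapExp ∧ B.IsRightLapExp ∧ CactoidDistance.IsLaplacianLike B.L ∧
    (IsUnit B.lam →
      IsUnit Wc ∧ Wc⁻¹ = -B.L + Ring.inverse B.lam • Matrix.vecMulVec B.β B.α) := by
  subst hWc hB
  have hb : ∀ i, (H i).IsBlock := fun i => (hblock _).2 ⟨i, rfl⟩
  have : Nonempty V := hG.1.1
  have : ∀ i, NeZero (n i) := fun i => ⟨by have := (he i).1; omega⟩
  have hgate := isGatedMatrix_distMatrix hG w hH hblock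
  have hA : ∀ i, (naturalBlockBag w (e i)).A = (distMatrix G w).submatrix
      (Subtype.val : (H i).verts → V) (Subtype.val : (H i).verts → V) := by
    intro i
    ext x y
    obtain ⟨k, rfl⟩ := (e i).surjective x
    obtain ⟨l, rfl⟩ := (e i).surjective y
    simp [naturalBlockBag, naturalBag, Bag.reindex,
      distMatrix_eq_cycleDist hG w (hb i) (he i) k l]
  have hleft := hgate.isLeftLapExp hA fun i => (naturalBag_isLeftLapExp (hw i)).reindex (e i)
  have hright := hgate.isRightLapExp hA fun i => (naturalBag_isRightLapExp (hw i)).reindex (e i)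
  refine ⟨fun _ _ _ hp => Walk.weight_eq_distMatrix hG w hp, hA, hleft, hright,
    ⟨hleft.2.1, hright.2.1⟩, fun hlam => ?_⟩
  have hinv := hright.mul_eq_one hlam
  exact ⟨IsUnit.of_mul_eq_one _ hinv, Matrix.inv_eq_right_inv hinv⟩
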